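/- Let $d\ge 3$, let $T_d$ be the infinite $d$-regular tree, and equip $\operatorname{Aut}(T_d)$ with the topology of pointwise convergence on the vertex set. Fix a legal labelling of $T_d$, i.e. a map $l$ from the set of (unoriented) edges to $\{1,\dots,d\}$ which, for every vertex $v$, restricts to a bijection $l_v$ from the set $E(v)$ of edges incident to $v$ onto $\{1,\dots,d\}$. For $g\in\operatorname{Aut}(T_d)$ and a vertex $v$ let $\sigma(g,v)=l_{gv}\circ g|_{E(v)}\circ l_v^{-1}\in S_d$ be the local action of $g$ at $v$. For a subgroup $F\le S_d$, the Burger–Mozes group is $$U(F)=\{g\in\operatorname{Aut}(T_d) : \sigma(g,v)\in F \text{ for every vertex } v\},$$ with the subspace topology. Then for every subgroup $F\le S_d$ the amenable radical of $U(F)$, i.e. its largest closed normal amenable subgroup, is trivial. -/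

import Mathlib

open Topology

/-! ### Amenability of topological groups and the amenable radical -/

/-- The space `UCB(G)` of bounded functions `f : G → ℝ` that are uniformly continuous in the sense
that `x ↦ f (u * x)` tends to `f` in the supremum norm as `u → 1`; in other words, those bounded
functions whose orbit map under left translation is norm continuous. -/
def UCB (G : Type*) [Group G] [TopologicalSpace G] : Submodule ℝ (G → ℝ) where
  carrier := {f | (∃ C : ℝ, ∀ x, |f x| ≤ C) ∧
    ∀ ε : ℝ, 0 < ε → ∀ᶠ u in 𝓝 (1 : G), ∀ x, |f (u * x) - f x| ≤ ε}
  zero_mem' := ⟨⟨0, by simp⟩, fun ε hε => by simp [hε.le]⟩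
  add_mem' := by
    rintro f g ⟨⟨C, hC⟩, hf⟩ ⟨⟨D, hD⟩, hg⟩
    refine ⟨⟨C + D, fun x => (abs_add_le _ _).trans (add_le_add (hC x) (hD x))⟩, fun ε hε => ?_⟩
    filter_upwards [hf (ε / 2) (half_pos hε), hg (ε / 2) (half_pos hε)] with u h1 h2 x
    have e : (f + g) (u * x) - (f + g) x = (f (u * x) - f x) + (g (u * x) - g x) := by
      simp only [Pi.add_apply]; ring
    rw [e]
    linarith [abs_add_le (f (u * x) - f x) (g (u * x) - g x), h1 x, h2 x]
  smul_mem' := by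
    rintro c f ⟨⟨C, hC⟩, hf⟩
    refine ⟨⟨|c| * C, fun x => ?_⟩, fun ε hε => ?_⟩
    · simp only [Pi.smul_apply, smul_eq_mul, abs_mul]
      exact mul_le_mul_of_nonneg_left (hC x) (abs_nonneg c)
    · have hc : 0 < |c| + 1 := by positivity
      filter_upwards [hf (ε / (|c| + 1)) (div_pos hε hc)] with u h x
      simp only [Pi.smul_apply, smul_eq_mul, ← mul_sub, abs_mul]
      calc |c| * |f (u * x) - f x| ≤ (|c| + 1) * (ε / (|c| + 1)) :=
            mul_le_mul (by linarith) (h x) (abs_nonneg _) hc.le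
        _ = ε := by field_simp

namespace UCB

variable {G : Type*} [Group G] [TopologicalSpace G]

/-- The constant function `1`. -/
def one : UCB G := ⟨fun _ => 1, ⟨1, by simp⟩, fun ε hε => by simp [hε.le]⟩

/-- The translate `x ↦ f (g * x)` of `f`. -/
def translate [IsTopologicalGroup G] (g : G) (f : UCB G) : UCB G :=
  ⟨fun x => f.1 (g * x), ⟨f.2.1.choose, fun x => f.2.1.choose_spec (g * x)⟩, fun ε hε => by
    have ht : Filter.Tendsto (fun u : G => g * u * g⁻¹) (𝓝 1) (𝓝 1) := by
      have hc : Continuous (fun u : G => g * u * g⁻¹) := by fun_prop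
      simpa using hc.tendsto 1
    filter_upwards [ht.eventually (f.2.2 ε hε)] with u h x
    have := h (g * x)
    simpa [mul_assoc] using this⟩

end UCB

/-- A topological group is amenable if there is a left-invariant mean on `UCB(G)`, that is, a
positive normalized linear functional that is invariant under left translations. For locally
compact groups this is equivalent to the existence of a left-invariant mean on `L^∞(G)`. -/
def IsAmenableGroup (G : Type*) [Group G] [TopologicalSpace G] [IsTopologicalGroup G] : Prop :=
  ∃ M : UCB G →ₗ[ℝ] ℝ, (∀ f : UCB G, (∀ x, 0 ≤ f.1 x) → 0 ≤ M f) ∧ M UCB.one = 1 ∧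
    ∀ (g : G) (f : UCB G), M (UCB.translate g f) = M f

/-- `R` is the amenable radical of `G`: the largest closed normal amenable subgroup of `G`. -/
def IsAmenableRadical {G : Type*} [Group G] [TopologicalSpace G] [IsTopologicalGroup G]
    (R : Subgroup G) : Prop :=
  IsGreatest {N : Subgroup G | N.Normal ∧ IsClosed (N : Set G) ∧ IsAmenableGroup N} R

/-! ### The automorphism group of a graph as a topological group -/

/-- The topology of pointwise convergence on the vertices (a discrete set) on the automorphism
group of a graph. -/
instance SimpleGraph.autTopologicalSpace {V : Type*} (T : SimpleGraph V) :
    TopologicalSpace (T ≃g T) :=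
  TopologicalSpace.induced (fun (g : T ≃g T) (v : V) => g v)
    (@Pi.topologicalSpace V (fun _ => V) (fun _ => ⊥))

theorem SimpleGraph.tendsto_aut_iff {V : Type*} {T : SimpleGraph V} {ι : Type*} {l : Filter ι}
    {φ : ι → (T ≃g T)} {g : T ≃g T} :
    Filter.Tendsto φ l (𝓝 g) ↔ ∀ v, ∀ᶠ i in l, φ i v = g v := by
  letI : TopologicalSpace V := ⊥
  haveI : DiscreteTopology V := ⟨rfl⟩
  rw [nhds_induced, Filter.tendsto_comap_iff, tendsto_pi_nhds]
  simp only [nhds_discrete, Filter.tendsto_pure, Function.comp_apply]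

instance SimpleGraph.autIsTopologicalGroup {V : Type*} (T : SimpleGraph V) :
    IsTopologicalGroup (T ≃g T) where
  continuous_mul := by
    rw [continuous_iff_continuousAt]
    rintro ⟨g, h⟩
    refine SimpleGraph.tendsto_aut_iff.2 fun v => ?_
    have h1 := SimpleGraph.tendsto_aut_iff.1
      (continuous_fst.tendsto (g, h) : Filter.Tendsto _ _ (𝓝 g)) (h v)
    have h2 := SimpleGraph.tendsto_aut_iff.1
      (continuous_snd.tendsto (g, h) : Filter.Tendsto _ _ (𝓝 h)) v
    filter_upwards [h1, h2] with p hp1 hp2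
    simp only [RelIso.mul_apply, hp2, hp1]
  continuous_inv := by
    rw [continuous_iff_continuousAt]
    intro g
    refine SimpleGraph.tendsto_aut_iff.2 fun v => ?_
    have h1 := SimpleGraph.tendsto_aut_iff.1 (Filter.tendsto_id : Filter.Tendsto id (𝓝 g) (𝓝 g))
      (g⁻¹ v)
    filter_upwards [h1] with p hp
    rw [id, RelIso.apply_inv_self] at hp
    apply p.injective
    rw [RelIso.apply_inv_self, hp]

/-! ### Burger–Mozes groups -/

/-- A legal labelling of a graph: a labelling of the (geometric) edges with labels `1, …, d` such
that at every vertex each label occurs on exactly one incident edge. -/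
structure LegalLabelling {V : Type*} (T : SimpleGraph V) (d : ℕ) where
  label : T.EdgeLabeling (Fin d)
  bijective : ∀ v : V,
    Function.Bijective (fun w : T.neighborSet v => label ⟨s(v, (w : V)), w.2⟩)

namespace LegalLabelling

variable {V : Type*} {T : SimpleGraph V} {d : ℕ} (c : LegalLabelling T d)

/-- The bijection from the edges at `v` (given by their other endpoints) to the set of labels. -/
noncomputable def star (v : V) : T.neighborSet v ≃ Fin d := Equiv.ofBijective _ (c.bijective v)

/-- The local action `σ(g, v)` of the automorphism `g` at the vertex `v`: the permutation of the
set of labels that sends the label of each edge `e` at `v` to the label of the edge `g e`. -/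
noncomputable def localAction (g : T ≃g T) (v : V) : Equiv.Perm (Fin d) :=
  (c.star v).symm.trans ((g.mapNeighborSet v).trans (c.star (g v)))

theorem localAction_one (v : V) : c.localAction 1 v = 1 := by
  ext i
  exact congrArg Fin.val ((c.star v).apply_symm_apply i)

theorem localAction_mul (g h : T ≃g T) (v : V) :
    c.localAction (g * h) v = c.localAction g (h v) * c.localAction h v := by
  ext i
  simp only [localAction, Equiv.Perm.mul_apply, Equiv.trans_apply, Equiv.symm_apply_apply]
  rfl

/-- The Burger–Mozes group `U(F)`: all automorphisms whose local actions all belong to `F`. -/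
noncomputable def burgerMozes (F : Subgroup (Equiv.Perm (Fin d))) : Subgroup (T ≃g T) where
  carrier := {g | ∀ v, c.localAction g v ∈ F}
  one_mem' := fun v => by rw [localAction_one]; exact F.one_mem
  mul_mem' := fun {g h} hg hh v => by
    rw [localAction_mul]; exact F.mul_mem (hg (h v)) (hh v)
  inv_mem' := fun {g} hg v => by
    have e : c.localAction g (g⁻¹ v) * c.localAction g⁻¹ v = 1 := by
      rw [← localAction_mul, mul_inv_cancel, localAction_one]
    rw [eq_inv_of_mul_eq_one_right e]
    exact F.inv_mem (hg (g⁻¹ v))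

end LegalLabelling

/-!
Let `N` be a nontrivial normal subgroup of `U(F)` with an invariant mean. For adjacent vertices
`x`, `y` write `H(x, y)` for the half-tree of all vertices closer to `y` than to `x`; the complement
of `H(x, y)` is `H(y, x)`. Evaluating the mean at the functions `n ↦ 1_{H(x, y)}(n v₀)`, which are
uniformly continuous because a neighbourhood of `1` fixes `x` and `y`, gives a finitely additive
`N`-invariant probability `m` on half-trees (`IsAmenableGroup.exists_halfTree_mean`).

The group `U(F)` contains for every edge a label-preserving flip `γ` of that edge
(`LegalLabelling.exists_flip`). If `n ∈ N` moves the edge `{x, y}`, then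
`t = (n γ n⁻¹) γ⁻¹` belongs to `N` and is the product of the inversions of two distinct edges, hence
a hyperbolic automorphism: it maps `H(x, y)`, for the right orientation of the edge, into itself.
As `m` is invariant, `H(x, y) \ t H(x, y)` is a null set, and since every vertex has
at least three neighbours it contains a half-tree `H(y, z)`
(`SimpleGraph.IsTree.exists_halfTree_subset_diff`). Conjugating `t` by the flip of `{y, z}` shows in
the same way that the opposite half-tree `H(z, y)` is null. Hence `1 = m(H(y, z)) + m(H(z, y)) = 0`,
a contradiction.
-/

/-! ### Half-trees -/

namespace SimpleGraph

variable {V : Type*} {T : SimpleGraph V}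

theorem Iso.dist_apply (g : T ≃g T) (hT : T.Connected) (u v : V) :
    T.dist (g u) (g v) = T.dist u v := by
  have key : ∀ (h : T ≃g T) (a b : V), T.dist (h a) (h b) ≤ T.dist a b := by
    intro h a b
    obtain ⟨p, hp⟩ := hT.exists_walk_length_eq_dist a b
    rw [← hp, ← Walk.length_map h.toHom p]
    exact dist_le _
  refine le_antisymm (key g u v) ?_
  simpa using key g.symm (g u) (g v)

theorem Connected.exists_adj_dist_eq_add_one (hT : T.Connected) {u v : V} (h : u ≠ v) :
    ∃ p, T.Adj u p ∧ T.dist u v = T.dist p v + 1 := by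
  obtain ⟨w, hw⟩ := hT.exists_walk_length_eq_dist u v
  cases w with
  | nil => exact absurd rfl h
  | @cons _ p _ hup q =>
    refine ⟨p, hup, ?_⟩
    have h1 := dist_le q
    have h2 := hT.dist_triangle (u := u) (v := p) (w := v)
    rw [dist_eq_one_iff_adj.2 hup] at h2
    rw [Walk.length_cons] at hw
    omega

theorem IsTree.eq_of_adj_of_dist_lt (hT : T.IsTree) {a p q y : V} (hp : T.Adj a p)
    (hq : T.Adj a q) (hpy : T.dist p y < T.dist a y) (hqy : T.dist q y < T.dist a y) : p = q := by
  have key : ∀ r, T.Adj a r → T.dist r y < T.dist a y →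
      ∃ w : T.Walk a y, w.IsPath ∧ w.snd = r := by
    intro r hr hry
    obtain ⟨w, hw⟩ := hT.connected.exists_walk_length_eq_dist r y
    refine ⟨Walk.cons hr w, Walk.isPath_of_length_eq_dist _ ?_, Walk.snd_cons _ _⟩
    have := hT.connected.dist_triangle (u := a) (v := r) (w := y)
    rw [dist_eq_one_iff_adj.2 hr] at this
    rw [Walk.length_cons]
    omega
  obtain ⟨w₁, h₁, rfl⟩ := key p hp hpy
  obtain ⟨w₂, h₂, rfl⟩ := key q hq hqy
  rw [(hT.existsUnique_path a y).unique h₁ h₂]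

/-- The half-tree `H(x, y)`: the vertices that are closer to `y` than to `x`. For adjacent vertices
`x`, `y` of a tree this is the component of `y` after removal of the edge `{x, y}`. -/
def halfTree (T : SimpleGraph V) (x y : V) : Set V := {v | T.dist v y < T.dist v x}

theorem mem_halfTree {x y v : V} : v ∈ T.halfTree x y ↔ T.dist v y < T.dist v x := Iff.rfl

theorem Iso.mem_halfTree_apply_iff (g : T ≃g T) (hT : T.Connected) {x y v : V} :
    g v ∈ T.halfTree (g x) (g y) ↔ v ∈ T.halfTree x y := by
  simp only [mem_halfTree, g.dist_apply hT]

theorem Iso.halfTree_apply (g : T ≃g T) (hT : T.Connected) (x y : V) :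
    T.halfTree (g x) (g y) = g '' T.halfTree x y := by
  ext v
  obtain ⟨u, rfl⟩ := g.surjective v
  rw [g.mem_halfTree_apply_iff hT, g.injective.mem_set_image]

theorem IsTree.compl_halfTree (hT : T.IsTree) {x y : V} (h : T.Adj x y) :
    (T.halfTree x y)ᶜ = T.halfTree y x := by
  ext v
  have := hT.dist_ne_of_adj v h
  simp only [Set.mem_compl_iff, mem_halfTree]
  omega

/-- The only edge from one half-tree to the opposite one is the edge that defines them. -/
theorem IsTree.eq_of_adj_of_mem_halfTree (hT : T.IsTree) {x y a b : V} (hxy : T.Adj x y)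
    (hab : T.Adj a b) (ha : a ∈ T.halfTree y x) (hb : b ∈ T.halfTree x y) : a = x ∧ b = y := by
  rw [mem_halfTree] at ha hb
  have h1 := hT.dist_eq_dist_add_one_of_adj a hxy
  have h2 := hT.dist_eq_dist_add_one_of_adj b hxy
  have hab1 := dist_eq_one_iff_adj.2 hab
  have h3 := hT.connected.dist_triangle (u := a) (v := b) (w := y)
  have h4 := hT.connected.dist_triangle (u := b) (v := a) (w := x)
  rw [dist_comm] at hab1
  have hab2 := dist_eq_one_iff_adj.2 hab
  by_cases hax : a = x
  · refine ⟨hax, ?_⟩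
    subst hax
    rw [dist_self] at h1 h4
    exact hT.connected.dist_eq_zero_iff.1 (by omega)
  -- Otherwise `b` and the neighbour of `a` towards `x` are both the neighbour of `a` towards `y`.
  · exfalso
    obtain ⟨p, hap, hp⟩ := hT.connected.exists_adj_dist_eq_add_one hax
    have h5 := hT.connected.dist_triangle (u := p) (v := x) (w := y)
    rw [dist_eq_one_iff_adj.2 hxy] at h5
    have hpb : p = b := hT.eq_of_adj_of_dist_lt hap hab (y := y) (by omega) (by omega)
    subst hpb
    omega

/-- A geodesic between opposite half-trees passes through the edge that defines them. -/
theorem IsTree.dist_eq_of_mem_halfTree (hT : T.IsTree) {x y v w : V} (hxy : T.Adj x y)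
    (hv : v ∈ T.halfTree y x) (hw : w ∈ T.halfTree x y) :
    T.dist v w = T.dist v x + 1 + T.dist y w := by
  refine le_antisymm ?_ ?_
  · have h1 := hT.connected.dist_triangle (u := v) (v := x) (w := w)
    have h2 := hT.connected.dist_triangle (u := x) (v := y) (w := w)
    rw [dist_eq_one_iff_adj.2 hxy] at h2
    omega
  · have key : ∀ {a b : V} (p : T.Walk a b), a ∈ T.halfTree y x → b ∈ T.halfTree x y →
        T.dist a x + 1 + T.dist y b ≤ p.length := by
      intro a b p
      induction p with
      | nil =>
        intro h1 h2
        rw [mem_halfTree] at h1 h2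
        omega
      | @cons a c b hac p ih =>
        intro h1 h2
        rw [Walk.length_cons]
        by_cases hc : c ∈ T.halfTree y x
        · have := ih hc h2
          have := hT.connected.dist_triangle (u := a) (v := c) (w := x)
          rw [dist_eq_one_iff_adj.2 hac] at this
          omega
        · rw [← hT.compl_halfTree hxy, Set.notMem_compl_iff] at hc
          obtain ⟨rfl, rfl⟩ := hT.eq_of_adj_of_mem_halfTree hxy hac h1 hc
          have := dist_le p
          rw [dist_self]
          omega
    obtain ⟨p, hp⟩ := hT.connected.exists_walk_length_eq_dist v w
    rw [← hp]
    exact key p hv hw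

theorem IsTree.halfTree_subset_halfTree (hT : T.IsTree) {x y p q : V} (hxy : T.Adj x y)
    (hp : p ∈ T.halfTree x y) (hq : q ∈ T.halfTree x y) (hy : y ∈ T.halfTree q p) :
    T.halfTree p q ⊆ T.halfTree x y := by
  intro v hv
  by_contra hvn
  rw [← Set.mem_compl_iff, hT.compl_halfTree hxy] at hvn
  have h1 := hT.dist_eq_of_mem_halfTree hxy hvn hp
  have h2 := hT.dist_eq_of_mem_halfTree hxy hvn hq
  rw [mem_halfTree] at hv hy
  omega

/-! ### Null half-trees -/

theorem IsRegularOfDegree.exists_adj_ne_ne [T.LocallyFinite] {d : ℕ} (hd : 3 ≤ d)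
    (hreg : T.IsRegularOfDegree d) (y a b : V) : ∃ z, T.Adj y z ∧ z ≠ a ∧ z ≠ b := by
  classical
  have h : ((T.neighborFinset y) \ {a, b}).Nonempty := by
    rw [← Finset.card_pos]
    have h1 := Finset.le_card_sdiff {a, b} (T.neighborFinset y)
    have h2 : ({a, b} : Finset V).card ≤ 2 := Finset.card_le_two
    rw [card_neighborFinset_eq_degree, hreg y] at h1
    omega
  obtain ⟨z, hz⟩ := h
  simp only [Finset.mem_sdiff, mem_neighborFinset, Finset.mem_insert, Finset.mem_singleton,
    not_or] at hz
  exact ⟨z, hz⟩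

/-- A nontrivial automorphism moves some edge into one of the two half-trees of that edge. -/
theorem IsTree.exists_map_mem_halfTree [T.LocallyFinite] (hT : T.IsTree) {d : ℕ} (hd : 3 ≤ d)
    (hreg : T.IsRegularOfDegree d) {n : T ≃g T} (hn : n ≠ 1) :
    ∃ x y, T.Adj x y ∧ n x ∈ T.halfTree x y ∧ n y ∈ T.halfTree x y := by
  obtain ⟨v, hv⟩ : ∃ v, n v ≠ v := by
    by_contra! h
    exact hn (RelIso.ext h)
  obtain ⟨u, hvu, hu, -⟩ := hreg.exists_adj_ne_ne hd v (n v) (n v)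
  have hadj : T.Adj (n v) (n u) := n.map_adj_iff.2 hvu
  have hc := hT.compl_halfTree hvu
  by_cases h1 : n v ∈ T.halfTree v u <;> by_cases h2 : n u ∈ T.halfTree v u
  · exact ⟨v, u, hvu, h1, h2⟩
  · rw [← Set.mem_compl_iff, hc] at h2
    exact absurd (hT.eq_of_adj_of_mem_halfTree hvu hadj.symm h2 h1).2.symm hu
  · rw [← Set.mem_compl_iff, hc] at h1
    exact absurd (hT.eq_of_adj_of_mem_halfTree hvu hadj h1 h2).1 hv
  · rw [← Set.mem_compl_iff, hc] at h1 h2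
    exact ⟨u, v, hvu.symm, h2, h1⟩

/-- If the edge `{p, q}` lies in the half-tree `H(x, y)`, then the product of an inversion `g` of
`{p, q}` and an inversion of `{x, y}`, which maps `H(x, y)` to `H(g y, g x)`, maps `H(x, y)` into
itself, and the difference contains a half-tree at `y`. -/
theorem IsTree.exists_halfTree_subset_diff [T.LocallyFinite] (hT : T.IsTree) {d : ℕ} (hd : 3 ≤ d)
    (hreg : T.IsRegularOfDegree d) {x y p q : V} (hxy : T.Adj x y) (hpq : T.Adj p q)
    (hp : p ∈ T.halfTree x y) (hq : q ∈ T.halfTree x y) {g : T ≃g T} (hgp : g p = q)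
    (hgq : g q = p) :
    T.halfTree (g y) (g x) ⊆ T.halfTree x y ∧ ∃ z, T.Adj y z ∧
      T.halfTree y z ⊆ T.halfTree x y ∧ Disjoint (T.halfTree y z) (T.halfTree (g y) (g x)) := by
  wlog hy : y ∈ T.halfTree q p generalizing p q
  · rw [← Set.mem_compl_iff, hT.compl_halfTree hpq.symm] at hy
    exact this hpq.symm hq hp hgq hgp hy
  have hsub := hT.halfTree_subset_halfTree hxy hp hq hy
  have hg : T.halfTree (g y) (g x) ⊆ T.halfTree p q := by
    have h1 : T.halfTree y x ⊆ T.halfTree q p := by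
      rw [← hT.compl_halfTree hxy, ← hT.compl_halfTree hpq]
      exact Set.compl_subset_compl.2 hsub
    have h2 := Set.image_mono (f := g) h1
    rwa [← g.halfTree_apply hT.connected, ← g.halfTree_apply hT.connected, hgq, hgp] at h2
  have hyq : y ≠ q := by
    rintro rfl
    rw [mem_halfTree, dist_self] at hy
    omega
  -- `r` is the neighbour of `y` towards `q`; the half-tree at `y` must avoid it and `x`.
  obtain ⟨r, hyr, hr⟩ := hT.connected.exists_adj_dist_eq_add_one hyq
  obtain ⟨z, hyz, hzx, hzr⟩ := hreg.exists_adj_ne_ne hd y x r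
  have hqz : q ∈ T.halfTree z y := by
    rw [← hT.compl_halfTree hyz, Set.mem_compl_iff, mem_halfTree, dist_comm,
      T.dist_comm (u := q)]
    exact fun h => hzr (hT.eq_of_adj_of_dist_lt hyz hyr h (by omega))
  have hxz : x ∈ T.halfTree z y := by
    rw [← hT.compl_halfTree hyz, Set.mem_compl_iff, mem_halfTree, dist_eq_one_iff_adj.2 hxy]
    intro h
    exact hzx (hT.connected.dist_eq_zero_iff.1 (by omega : T.dist x z = 0)).symm
  refine ⟨hg.trans hsub, z, hyz, fun v hv => ?_, Set.disjoint_left.2 fun v hv hv' => ?_⟩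
  · have h1 := hT.dist_eq_of_mem_halfTree hyz.symm hv hxz
    have h2 := hT.dist_eq_dist_add_one_of_adj v hyz
    rw [mem_halfTree] at hv ⊢
    have h3 := hT.connected.pos_dist_of_ne hxy.ne'
    omega
  · have h1 := hT.dist_eq_of_mem_halfTree hyz.symm hv hqz
    have h2 := hT.dist_eq_dist_add_one_of_adj v hyz
    have h3 := hT.connected.dist_triangle (u := v) (v := y) (w := p)
    have h4 := hg hv'
    rw [mem_halfTree] at hv hy h4
    omega

end SimpleGraph

/-! ### Label-preserving flips of edges -/

namespace LegalLabelling

open SimpleGraph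

variable {V : Type*} {T : SimpleGraph V} {d : ℕ} (c : LegalLabelling T d)

/-- The other endpoint of the edge at `v` with label `i`. -/
noncomputable def neighbor (i : Fin d) (v : V) : V := (c.star v).symm i

theorem adj_neighbor (i : Fin d) (v : V) : T.Adj v (c.neighbor i v) := ((c.star v).symm i).2

theorem neighbor_star {v w : V} (h : T.Adj v w) : c.neighbor (c.star v ⟨w, h⟩) v = w := by
  rw [neighbor, Equiv.symm_apply_apply]

theorem star_neighbor (i : Fin d) (v : V) :
    c.star v ⟨c.neighbor i v, c.adj_neighbor i v⟩ = i :=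
  (c.star v).apply_symm_apply i

theorem neighbor_left_injective (v : V) : Function.Injective fun i => c.neighbor i v :=
  fun _ _ h => (c.star v).symm.injective (Subtype.ext h)

theorem star_comm {v w : V} (h : T.Adj v w) : c.star v ⟨w, h⟩ = c.star w ⟨v, h.symm⟩ :=
  congrArg c.label (Subtype.ext Sym2.eq_swap)

@[simp]
theorem neighbor_neighbor (i : Fin d) (v : V) : c.neighbor i (c.neighbor i v) = v := by
  have h := c.neighbor_star (c.adj_neighbor i v).symm
  rwa [← c.star_comm (c.adj_neighbor i v), star_neighbor] at h

theorem exists_neighbor_eq {v w : V} (h : T.Adj v w) : ∃ i, c.neighbor i v = w :=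
  ⟨_, c.neighbor_star h⟩

theorem exists_neighbor_eq_of_ne (hT : T.IsTree) {x u : V} (h : u ≠ x) :
    ∃ q : V × Fin d, c.neighbor q.2 q.1 = u ∧ T.dist q.1 x < T.dist u x := by
  obtain ⟨p, hp, hd⟩ := hT.connected.exists_adj_dist_eq_add_one h
  obtain ⟨i, hi⟩ := c.exists_neighbor_eq hp.symm
  exact ⟨(p, i), hi, by simp only; omega⟩

open Classical in
/-- The label-preserving map that sends `x` to `w`, built outwards from `x`: the image of a vertex
is determined by the image of its neighbour towards `x` and the label of the edge in between. -/
noncomputable def transport (hT : T.IsTree) (x w u : V) : V :=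
  if h : u = x then w else
    c.neighbor (c.exists_neighbor_eq_of_ne hT h).choose.2
      (transport hT x w (c.exists_neighbor_eq_of_ne hT h).choose.1)
termination_by T.dist u x
decreasing_by exact (c.exists_neighbor_eq_of_ne hT h).choose_spec.2

theorem transport_self (hT : T.IsTree) (x w : V) : c.transport hT x w x = w := by
  rw [transport, dif_pos rfl]

theorem transport_neighbor_of_dist_lt (hT : T.IsTree) (x w : V) {u : V} {i : Fin d}
    (h : T.dist u x < T.dist (c.neighbor i u) x) :
    c.transport hT x w (c.neighbor i u) = c.neighbor i (c.transport hT x w u) := by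
  have hne : c.neighbor i u ≠ x := by
    intro e
    rw [e, dist_self] at h
    omega
  rw [transport, dif_neg hne]
  obtain ⟨h1, h2⟩ := (c.exists_neighbor_eq_of_ne hT hne).choose_spec
  generalize (c.exists_neighbor_eq_of_ne hT hne).choose = q at h1 h2
  have hq : q.1 = u := by
    refine hT.eq_of_adj_of_dist_lt (y := x) ?_ (c.adj_neighbor i u).symm h2 h
    rw [← h1]
    exact (c.adj_neighbor _ _).symm
  have hi : q.2 = i := by
    rw [hq] at h1
    exact c.neighbor_left_injective u h1
  rw [hq, hi]

theorem transport_neighbor (hT : T.IsTree) (x w u : V) (i : Fin d) :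
    c.transport hT x w (c.neighbor i u) = c.neighbor i (c.transport hT x w u) := by
  have h := hT.dist_ne_of_adj x (c.adj_neighbor i u)
  rw [dist_comm, T.dist_comm (u := x)] at h
  rcases lt_or_gt_of_ne h with h | h
  · exact c.transport_neighbor_of_dist_lt hT x w h
  · have h' : T.dist (c.neighbor i u) x < T.dist (c.neighbor i (c.neighbor i u)) x := by
      rwa [neighbor_neighbor]
    have := c.transport_neighbor_of_dist_lt hT x w h'
    rw [neighbor_neighbor] at this
    rw [this, neighbor_neighbor]

theorem eq_id_of_map_neighbor (hT : T.Connected) {φ : V → V}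
    (hφ : ∀ i u, φ (c.neighbor i u) = c.neighbor i (φ u)) {x : V} (hx : φ x = x) (u : V) :
    φ u = u := by
  obtain ⟨p⟩ := hT.preconnected u x
  induction p with
  | nil => exact hx
  | @cons a b _ hab p ih =>
    obtain ⟨i, rfl⟩ := c.exists_neighbor_eq hab.symm
    rw [hφ, ih hx]

/-- Every edge is inverted by a label-preserving automorphism, which belongs to every Burger–Mozes
group. -/
theorem exists_flip (hT : T.IsTree) (F : Subgroup (Equiv.Perm (Fin d))) {x y : V}
    (hxy : T.Adj x y) : ∃ g ∈ c.burgerMozes F, g x = y ∧ g y = x := by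
  set φ := c.transport hT x y with hφ
  have hn : ∀ i u, φ (c.neighbor i u) = c.neighbor i (φ u) :=
    fun i u => c.transport_neighbor hT x y u i
  have hx : φ x = y := c.transport_self hT x y
  have hy : φ y = x := by
    obtain ⟨i, hi⟩ := c.exists_neighbor_eq hxy
    rw [← hi, hn, hx, ← hi, neighbor_neighbor]
  have hinv : ∀ u, φ (φ u) = u := fun u =>
    c.eq_id_of_map_neighbor hT.connected (φ := φ ∘ φ)
      (fun i u => by simp only [Function.comp_apply, hn]) (x := x) (by simp [hx, hy]) u
  have hadj : ∀ a b, T.Adj a b → T.Adj (φ a) (φ b) := by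
    intro a b hab
    obtain ⟨i, rfl⟩ := c.exists_neighbor_eq hab
    rw [hn]
    exact c.adj_neighbor i _
  let g : T ≃g T :=
    { toFun := φ
      invFun := φ
      left_inv := hinv
      right_inv := hinv
      map_rel_iff' := fun {a b} => ⟨fun h => by simpa [hinv] using hadj _ _ h, hadj a b⟩ }
  refine ⟨g, fun v => ?_, hx, hy⟩
  have : c.localAction g v = 1 := by
    refine Equiv.ext fun i => ?_
    have h1 : g.mapNeighborSet v ((c.star v).symm i) = (c.star (g v)).symm i :=
      Subtype.ext (hn i v)
    rw [localAction, Equiv.trans_apply, Equiv.trans_apply, h1, Equiv.apply_symm_apply]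
    rfl
  rw [this]
  exact F.one_mem

end LegalLabelling

/-! ### The invariant mean on half-trees -/

section Mean

open SimpleGraph

variable {V : Type*} {T : SimpleGraph V}

open Classical in
/-- The function `g ↦ 1_{H(x, y)}(g v)` on a group acting continuously on a tree, as an element of
`UCB`. -/
noncomputable def UCB.halfTree {G : Type*} [Group G] [TopologicalSpace G] (ρ : G →* (T ≃g T))
    (hρ : Continuous ρ) (hT : T.Connected) (v x y : V) : UCB G :=
  ⟨fun g => if ρ g v ∈ T.halfTree x y then 1 else 0, ⟨1, fun g => by
    dsimp only
    split_ifs <;> simp⟩, fun ε hε => by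
    have h1 : Filter.Tendsto ρ (𝓝 1) (𝓝 1) := by simpa using hρ.tendsto 1
    have h2 := tendsto_aut_iff.1 h1
    filter_upwards [h2 x, h2 y] with u hx hy g
    have h3 := (ρ u).mem_halfTree_apply_iff hT (x := x) (y := y) (v := ρ g v)
    rw [hx, hy] at h3
    simp only [RelIso.one_apply] at h3
    simp only [map_mul, RelIso.mul_apply, h3, sub_self, abs_zero]
    exact hε.le⟩

/-- An amenable group acting continuously on a tree leaves invariant a finitely additive
probability on half-trees. Additivity is recorded only for complementary half-trees and as
superadditivity for two disjoint half-trees inside a third. -/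
theorem IsAmenableGroup.exists_halfTree_mean {G : Type*} [Group G] [TopologicalSpace G]
    [IsTopologicalGroup G] (hG : IsAmenableGroup G) (ρ : G →* (T ≃g T)) (hρ : Continuous ρ)
    (hT : T.IsTree) :
    ∃ m : V → V → ℝ, (∀ x y, 0 ≤ m x y) ∧ (∀ x y, T.Adj x y → m x y + m y x = 1) ∧
      (∀ g x y, m (ρ g x) (ρ g y) = m x y) ∧
      ∀ x y x' y' z w, T.halfTree x' y' ⊆ T.halfTree x y → T.halfTree z w ⊆ T.halfTree x y →
        Disjoint (T.halfTree z w) (T.halfTree x' y') → m z w + m x' y' ≤ m x y := by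
  obtain ⟨M, hpos, hone, hinv⟩ := hG
  obtain ⟨v⟩ := hT.connected.nonempty
  have hM : ∀ f g : UCB G, (∀ s, f.1 s ≤ g.1 s) → M f ≤ M g := by
    intro f g h
    rw [← sub_nonneg, ← map_sub]
    exact hpos _ fun s => sub_nonneg.2 (h s)
  refine ⟨fun x y => M (UCB.halfTree ρ hρ hT.connected v x y), fun x y => hpos _ fun s => ?_,
    fun x y hxy => ?_, fun g x y => ?_, fun x y x' y' z w h1 h2 h3 => ?_⟩
  · simp only [UCB.halfTree]
    split_ifs <;> norm_num
  · rw [← map_add, ← hone]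
    congr 1
    refine Subtype.ext (funext fun s => ?_)
    have h : ρ s v ∈ T.halfTree y x ↔ ρ s v ∉ T.halfTree x y := by
      rw [← hT.compl_halfTree hxy, Set.mem_compl_iff]
    simp only [UCB.halfTree, UCB.one, Submodule.coe_add, Pi.add_apply]
    split_ifs <;> first | tauto | norm_num
  · dsimp only
    rw [← hinv g]
    congr 1
    refine Subtype.ext (funext fun s => ?_)
    have h : ρ (g * s) v ∈ T.halfTree (ρ g x) (ρ g y) ↔ ρ s v ∈ T.halfTree x y := by
      rw [map_mul, RelIso.mul_apply, (ρ g).mem_halfTree_apply_iff hT.connected]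
    classical exact if_congr h rfl rfl
  · rw [← map_add]
    refine hM _ _ fun s => ?_
    have a1 := @h1 (ρ s v)
    have a2 := @h2 (ρ s v)
    have a3 : ρ s v ∈ T.halfTree z w → ρ s v ∉ T.halfTree x' y' :=
      fun h => Set.disjoint_left.1 h3 h
    simp only [UCB.halfTree, Submodule.coe_add, Pi.add_apply]
    split_ifs <;> first | tauto | norm_num

end Mean

/-! ### The amenable radical -/

theorem isAmenableGroup_of_subsingleton (G : Type*) [Group G] [TopologicalSpace G]
    [IsTopologicalGroup G] [Subsingleton G] : IsAmenableGroup G := by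
  refine ⟨(LinearMap.proj (1 : G)).comp (UCB G).subtype, fun f hf => hf 1, rfl, fun g f => ?_⟩
  exact congrArg f.1 (Subsingleton.elim _ _)

instance SimpleGraph.autT2Space {V : Type*} (T : SimpleGraph V) : T2Space (T ≃g T) := by
  let _ : TopologicalSpace V := ⊥
  have : DiscreteTopology V := ⟨rfl⟩
  exact T2Space.of_injective_continuous (f := fun (g : T ≃g T) (v : V) => g v)
    DFunLike.coe_injective continuous_induced_dom

theorem LegalLabelling.eq_bot_of_normal_of_isAmenableGroup {V : Type*} {d : ℕ} (hd : 3 ≤ d)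
    {T : SimpleGraph V} [T.LocallyFinite] (hT : T.IsTree) (hreg : T.IsRegularOfDegree d)
    (c : LegalLabelling T d) (F : Subgroup (Equiv.Perm (Fin d)))
    (N : Subgroup (c.burgerMozes F)) (hN : N.Normal) (hA : IsAmenableGroup N) : N = ⊥ := by
  rw [Subgroup.eq_bot_iff_forall]
  intro n hn
  by_contra hn1
  obtain ⟨m, hm0, hm1, hminv, hmadd⟩ := hA.exists_halfTree_mean
    ((c.burgerMozes F).subtype.comp N.subtype)
    (continuous_subtype_val.comp continuous_subtype_val) hT
  -- Null sets: half-trees in the difference of a half-tree and its image under an element of `N`.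
  have hnull : ∀ t ∈ N, ∀ x y z w, T.halfTree (t.1 x) (t.1 y) ⊆ T.halfTree x y →
      T.halfTree z w ⊆ T.halfTree x y →
      Disjoint (T.halfTree z w) (T.halfTree (t.1 x) (t.1 y)) → m z w = 0 := by
    intro t ht x y z w h1 h2 h3
    have h4 := hmadd x y _ _ z w h1 h2 h3
    have h5 : m (t.1 x) (t.1 y) = m x y := hminv ⟨t, ht⟩ x y
    have h6 := hm0 z w
    linarith
  obtain ⟨x, y, hxy, hx, hy⟩ := hT.exists_map_mem_halfTree hd hreg (n := n.1)
    (fun h => hn1 (Subtype.ext h))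
  obtain ⟨a, ha, hax, hay⟩ := c.exists_flip hT F hxy
  lift a to c.burgerMozes F using ha
  obtain ⟨h1, z, hyz, h2, h3⟩ := hT.exists_halfTree_subset_diff hd hreg hxy
    (n.1.map_adj_iff.2 hxy) hx hy (g := (n * a * n⁻¹).1)
    (by simp [RelIso.mul_apply, hax]) (by simp [RelIso.mul_apply, hay])
  -- The product of the inversions `n a n⁻¹` and `a⁻¹`, bracketed as a product of elements of `N`.
  set t : c.burgerMozes F := n * (a * n⁻¹ * a⁻¹) with ht
  have htN : t ∈ N := N.mul_mem hn (hN.conj_mem _ (N.inv_mem hn) a)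
  have hax' : (a⁻¹).1 x = y := a.1.symm_apply_eq.2 hay.symm
  have hay' : (a⁻¹).1 y = x := a.1.symm_apply_eq.2 hax.symm
  have htx : t.1 x = (n * a * n⁻¹).1 y := by
    rw [← hax', ht, ← mul_assoc, ← mul_assoc]
    rfl
  have hty : t.1 y = (n * a * n⁻¹).1 x := by
    rw [← hay', ht, ← mul_assoc, ← mul_assoc]
    rfl
  rw [← htx, ← hty] at h1 h3
  have hyz0 := hnull t htN x y y z h1 h2 h3
  obtain ⟨b, hb, hby, hbz⟩ := c.exists_flip hT F hyz
  lift b to c.burgerMozes F using hb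
  have hconj : ∀ u, (b * t * b⁻¹).1 (b.1 u) = b.1 (t.1 u) := by
    intro u
    simp [RelIso.mul_apply]
  have hzy0 : m z y = 0 := by
    have himg := b.1.halfTree_apply hT.connected
    have hz : T.halfTree z y = b.1 '' T.halfTree y z := by rw [← himg, hby, hbz]
    refine hnull _ (hN.conj_mem t htN b) (b.1 x) (b.1 y) z y ?_ ?_ ?_
    · rw [hconj, hconj, himg, himg]
      exact Set.image_mono h1
    · rw [hz, himg]
      exact Set.image_mono h2
    · rw [hconj, hconj, hz, himg]
      exact (Set.disjoint_image_iff b.1.injective).2 h3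
  have := hm1 y z hyz
  linarith

theorem mainTheorem9 {V : Type*} (d : ℕ) (hd : 3 ≤ d)
    (T : SimpleGraph V) [T.LocallyFinite] (hT : T.IsTree) (hreg : T.IsRegularOfDegree d)
    (c : LegalLabelling T d) (F : Subgroup (Equiv.Perm (Fin d))) :
    IsAmenableRadical (⊥ : Subgroup (c.burgerMozes F)) := by
  refine ⟨⟨inferInstance, ?_, isAmenableGroup_of_subsingleton _⟩, ?_⟩
  · rw [Subgroup.coe_bot]
    exact isClosed_singleton
  · rintro N ⟨hN, -, hA⟩
    exact (c.eq_bot_of_normal_of_isAmenableGroup hd hT hreg F N hN hA).le
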